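/- Let $M$ be a smooth Riemannian manifold of dimension $m$ and let $L\subset M$ be a closed (compact, without boundary) connected smoothly embedded submanifold of dimension $l<m$. For $\varepsilon>0$ let $L(\varepsilon)=\{y\in M: d(y,L)<\varepsilon\}$ be the $\varepsilon$-tube around $L$, and let $NL(\varepsilon)$ be the set of normal vectors to $L$ of length less than $\varepsilon$. Assume that for some $r>1$ the exponential map of $M$ is defined on $NL(r)$ and maps it diffeomorphically onto $L(r)$, and let $\pi:L(r)\to L$ be the resulting projection, $\pi(\exp v)=p$ for $v\in NL(r)$ normal to $L$ at $p$. Fix $0<T<\infty$, and let $Y=(Y_t)_{t\ge 0}$ be a stochastic process on $M$ with continuous paths and with $Y_0=x$ almost surely for some fixed $x\in L$, such that for every $\varepsilon>0$ the event $\{Y_t\in L(\varepsilon)\text{ for all }0\le t\le T\}$ has positive probability. Let $Y^\varepsilon=(Y^\varepsilon_t)_{0\le t\le T}$ denote the process $Y$ conditioned on this event. Then the following are equivalent: 1. the family of (the laws on the path space $C([0,T],L)$ of) the projected processes $(S^\varepsilon=\pi Y^\varepsilon: 0<\varepsilon\le 1)$ is tight; 2. the family of (the laws on the path space $C([0,T],M)$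 of) the conditioned processes $(Y^\varepsilon: 0<\varepsilon\le 1)$ is tight. Here the path spaces carry the topology of uniform convergence and its Borel $\sigma$-algebra, and a family of probability measures is tight if for every $\eta>0$ there is one compact set whose complement has measure at most $\eta$ for every measure of the family. -/

import Mathlib

open MeasureTheory Set Bundle
open scoped Manifold ContDiff NNReal ENNReal ProbabilityTheory

noncomputable section

namespace Tube

section Geometry

/-- `γ : [0, 1] → M` is the geodesic issuing from `z.proj` with initial velocity `z.snd`: its
one-sided velocity at `0` is `z`, and it is locally length-minimising with constant speed
`‖z.snd‖`, i.e. near every `t ∈ [0, 1]` the Riemannian distance between `γ s` and `γ s'` is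
`|s - s'| * ‖z.snd‖`. -/
structure IsGeodesicFrom {E : Type*} [NormedAddCommGroup E] [NormedSpace ℝ E]
    {H : Type*} [TopologicalSpace H] (I : ModelWithCorners ℝ E H)
    {M : Type*} [EMetricSpace M] [ChartedSpace H M] [IsManifold I ∞ M]
    [RiemannianBundle (fun x : M => TangentSpace I x)]
    (z : TangentBundle I M) (γ : ℝ → M) : Prop where
  differentiable : MDifferentiableWithinAt 𝓘(ℝ, ℝ) I γ (Icc 0 1) 0
  velocity : tangentMapWithin 𝓘(ℝ, ℝ) I γ (Icc 0 1) ⟨(0 : ℝ), (1 : ℝ)⟩ = z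
  locally_minimizing : ∀ t ∈ Icc (0 : ℝ) 1, ∃ δ > (0 : ℝ),
    ∀ s ∈ Icc (0 : ℝ) 1, ∀ s' ∈ Icc (0 : ℝ) 1, |s - t| < δ → |s' - t| < δ →
      edist (γ s) (γ s') = ENNReal.ofReal (|s - s'| * ‖z.snd‖)

/-- The domain of the exponential map: the tangent vectors whose geodesic exists up to time `1`. -/
def expDomain {E : Type*} [NormedAddCommGroup E] [NormedSpace ℝ E]
    {H : Type*} [TopologicalSpace H] (I : ModelWithCorners ℝ E H)
    (M : Type*) [EMetricSpace M] [ChartedSpace H M] [IsManifold I ∞ M]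
    [RiemannianBundle (fun x : M => TangentSpace I x)] : Set (TangentBundle I M) :=
  {z | ∃ γ : ℝ → M, IsGeodesicFrom I z γ}

open Classical in
/-- The Riemannian exponential map: `z` is sent to the position at time `1` of the geodesic with
initial velocity `z` (and, outside the domain, to the base point of `z`). -/
def expMap {E : Type*} [NormedAddCommGroup E] [NormedSpace ℝ E]
    {H : Type*} [TopologicalSpace H] (I : ModelWithCorners ℝ E H)
    {M : Type*} [EMetricSpace M] [ChartedSpace H M] [IsManifold I ∞ M]
    [RiemannianBundle (fun x : M => TangentSpace I x)] (z : TangentBundle I M) : M :=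
  if h : ∃ γ : ℝ → M, IsGeodesicFrom I z γ then h.choose 1 else z.proj

/-- The vector `v`, tangent to `M` at `ι p`, is normal to the submanifold `ι : L → M`. -/
def IsNormal {E' : Type*} [NormedAddCommGroup E'] [NormedSpace ℝ E']
    {H' : Type*} [TopologicalSpace H'] (I' : ModelWithCorners ℝ E' H')
    {E : Type*} [NormedAddCommGroup E] [NormedSpace ℝ E]
    {H : Type*} [TopologicalSpace H] (I : ModelWithCorners ℝ E H)
    {L : Type*} [TopologicalSpace L] [ChartedSpace H' L]
    {M : Type*} [EMetricSpace M] [ChartedSpace H M] [IsManifold I ∞ M]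
    [RiemannianBundle (fun x : M => TangentSpace I x)]
    (ι : L → M) (p : L) (v : TangentSpace I (ι p)) : Prop :=
  ∀ w : TangentSpace I' p, inner ℝ v (mfderiv I' I ι p w) = 0

/-- `NL(r)`: the normal vectors of length less than `r`, as a subset of the tangent bundle
of `M`. -/
def normalDisc {E' : Type*} [NormedAddCommGroup E'] [NormedSpace ℝ E']
    {H' : Type*} [TopologicalSpace H'] (I' : ModelWithCorners ℝ E' H')
    {E : Type*} [NormedAddCommGroup E] [NormedSpace ℝ E]
    {H : Type*} [TopologicalSpace H] (I : ModelWithCorners ℝ E H)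
    {L : Type*} [TopologicalSpace L] [ChartedSpace H' L]
    {M : Type*} [EMetricSpace M] [ChartedSpace H M] [IsManifold I ∞ M]
    [RiemannianBundle (fun x : M => TangentSpace I x)]
    (ι : L → M) (r : ℝ) : Set (TangentBundle I M) :=
  {z | ∃ (p : L) (v : TangentSpace I (ι p)), IsNormal I' I ι p v ∧ ‖v‖ < r ∧ z = ⟨ι p, v⟩}

/-- `L(ε)`: the points of `M` at distance less than `ε` from the submanifold `ι : L → M`. -/
def tube {L M : Type*} [EMetricSpace M] (ι : L → M) (ε : ℝ) : Set M :=
  Metric.thickening ε (range ι)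

/-- The exponential map is defined on `NL(r)` and maps it diffeomorphically onto `L(r)`. As
`NL(r)` is an embedded submanifold of the tangent bundle of `M`, smoothness of maps from or to it
is smoothness as maps from or to (subsets of) the tangent bundle. -/
def IsTubularRadius {E' : Type*} [NormedAddCommGroup E'] [NormedSpace ℝ E']
    {H' : Type*} [TopologicalSpace H'] (I' : ModelWithCorners ℝ E' H')
    {E : Type*} [NormedAddCommGroup E] [NormedSpace ℝ E]
    {H : Type*} [TopologicalSpace H] (I : ModelWithCorners ℝ E H)
    {L : Type*} [TopologicalSpace L] [ChartedSpace H' L]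
    {M : Type*} [EMetricSpace M] [ChartedSpace H M] [IsManifold I ∞ M]
    [RiemannianBundle (fun x : M => TangentSpace I x)]
    (ι : L → M) (r : ℝ) : Prop :=
  normalDisc I' I ι r ⊆ expDomain I M ∧
    BijOn (expMap I) (normalDisc I' I ι r) (tube ι r) ∧
    ContMDiffOn I.tangent I ∞ (expMap I) (normalDisc I' I ι r) ∧
    ∃ g : M → TangentBundle I M,
      InvOn g (expMap I) (normalDisc I' I ι r) (tube ι r) ∧
      ContMDiffOn I I.tangent ∞ g (tube ι r)

/-- The projection `π : L(r) → L`: the point `y = exp v`, with `v` normal to `L` at `p` and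
`‖v‖ < r`, is sent to `p`. (Its values outside `L(r)` are irrelevant.) -/
def proj {E' : Type*} [NormedAddCommGroup E'] [NormedSpace ℝ E']
    {H' : Type*} [TopologicalSpace H'] (I' : ModelWithCorners ℝ E' H')
    {E : Type*} [NormedAddCommGroup E] [NormedSpace ℝ E]
    {H : Type*} [TopologicalSpace H] (I : ModelWithCorners ℝ E H)
    {L : Type*} [TopologicalSpace L] [ChartedSpace H' L] [Nonempty L]
    {M : Type*} [EMetricSpace M] [ChartedSpace H M] [IsManifold I ∞ M]
    [RiemannianBundle (fun x : M => TangentSpace I x)]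
    (ι : L → M) (r : ℝ) (y : M) : L :=
  Classical.epsilon fun p : L =>
    ∃ v : TangentSpace I (ι p), IsNormal I' I ι p v ∧ ‖v‖ < r ∧ expMap I ⟨ι p, v⟩ = y

end Geometry

section Processes

/-- The path space `C([0, T], X)`, with the topology of uniform convergence. -/
abbrev PathSpace (T : ℝ≥0) (X : Type*) [TopologicalSpace X] : Type _ :=
  C(Icc (0 : ℝ≥0) T, X)

instance instMeasurableSpacePathSpace (T : ℝ≥0) (X : Type*) [TopologicalSpace X] :
    MeasurableSpace (PathSpace T X) := borel _

instance instBorelSpacePathSpace (T : ℝ≥0) (X : Type*) [TopologicalSpace X] :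
    BorelSpace (PathSpace T X) := ⟨rfl⟩

/-- The path up to time `T` of a process with continuous paths. -/
def pathUpTo {Ω X : Type*} [TopologicalSpace X] (T : ℝ≥0) (Y : ℝ≥0 → Ω → X)
    (hY : ∀ η, Continuous fun t => Y t η) (η : Ω) : PathSpace T X :=
  ⟨fun t => Y t η, (hY η).comp continuous_subtype_val⟩

/-- The event that the process stays in the set `A` up to time `T`. -/
def stays {Ω X : Type*} (T : ℝ≥0) (Y : ℝ≥0 → Ω → X) (A : Set X) : Set Ω :=
  {η | ∀ t ≤ T, Y t η ∈ A}

open Classical in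
/-- The image `f ∘ w` of a path `w` in `A` under a map `f` which is continuous on `A` (and a
constant path if `f ∘ w` is not such a path). -/
def mapPath {X Z : Type*} [TopologicalSpace X] [TopologicalSpace Z] [Nonempty Z] {T : ℝ≥0}
    (f : X → Z) (A : Set X) (w : PathSpace T X) : PathSpace T Z :=
  if h : (∀ t, w t ∈ A) ∧ Continuous fun t => f (w t) then ⟨fun t => f (w t), h.2⟩
  else ContinuousMap.const _ (Classical.arbitrary Z)

/-- The law on `C([0, T], X)` of the process `Y` conditioned to stay in `A` up to time `T`. -/
def condLaw {Ω X : Type*} [MeasurableSpace Ω] [TopologicalSpace X] (P : Measure Ω) (T : ℝ≥0)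
    (Y : ℝ≥0 → Ω → X) (hY : ∀ η, Continuous fun t => Y t η) (A : Set X) :
    Measure (PathSpace T X) :=
  (P[|stays T Y A]).map (pathUpTo T Y hY)

end Processes

end Tube

end

/-! Only two facts about π matter: it is continuous on the tube L(r), and it fixes L
(`continuousOn_proj`, `proj_apply`). From 2 to 1, tightness passes through composition with π, which
is continuous on paths in L(r). From 1 to 2, conditioning on an ε-tube with ε ≥ e costs at most the
factor 1/P(Y stays in the e-tube), so tightness of the single law of Y controls these ε. The
remaining paths lie in the e-tube, with projections mostly in a compact K'. With e = e_n → 0, the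
compact set is ⋂ (K_n ∪ F_n): K_n is compact, and F_n holds the paths in the closed e_n-tube
projecting into K'. It is compact (`isCompact_iInter_union`) because paths in ever thinner tubes are
uniformly close to their projections. -/

section

open Filter Topology

/-! ### Polish spaces and measurability of path-valued maps -/

/-- A locally compact, second countable, metrizable space is Polish: it is open in its completion
for any compatible metric. -/
theorem polishSpace_of_locallyCompactSpace (X : Type*) [TopologicalSpace X]
    [LocallyCompactSpace X] [SecondCountableTopology X] [TopologicalSpace.MetrizableSpace X] :
    PolishSpace X := by
  let := TopologicalSpace.metrizableSpaceMetric X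
  have he : IsEmbedding ((↑) : X → UniformSpace.Completion X) :=
    UniformSpace.Completion.isUniformEmbedding_coe X |>.isEmbedding
  have hd : DenseRange ((↑) : X → UniformSpace.Completion X) :=
    UniformSpace.Completion.denseRange_coe
  have hopen : IsOpen (range ((↑) : X → UniformSpace.Completion X)) := by
    rw [isOpen_iff_mem_nhds]
    rintro _ ⟨x, rfl⟩
    obtain ⟨K, hK, hxK⟩ := exists_compact_mem_nhds x
    rw [he.nhds_eq_comap, mem_comap] at hxK
    obtain ⟨V, hV, hVK⟩ := hxK
    obtain ⟨W, hWV, hW, hxW⟩ := mem_nhds_iff.1 hV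
    refine mem_of_superset (hW.mem_nhds hxW) ?_
    -- By density W is in the closure of its trace on X; that trace lies in the image of K, which is
    -- closed.
    have h1 : W ⊆ closure (W ∩ range ((↑) : X → UniformSpace.Completion X)) :=
      hd.open_subset_closure_inter hW
    have h2 : W ∩ range ((↑) : X → UniformSpace.Completion X) ⊆ (↑) '' K := by
      rintro _ ⟨hy, z, rfl⟩
      exact ⟨z, hVK (hWV hy), rfl⟩
    have h3 : IsClosed (((↑) : X → UniformSpace.Completion X) '' K) :=
      (hK.image he.continuous).isClosed
    exact h1.trans ((closure_minimal h2 h3).trans (image_subset_range _ _))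
  have : PolishSpace (range ((↑) : X → UniformSpace.Completion X)) := hopen.polishSpace
  exact he.toHomeomorph.isClosedEmbedding.polishSpace

theorem polishSpace_continuousMap (C X : Type*) [TopologicalSpace C] [CompactSpace C]
    [LocallyCompactSpace C] [SecondCountableTopology C] [TopologicalSpace X] [PolishSpace X] :
    PolishSpace C(C, X) := by
  let := TopologicalSpace.upgradeIsCompletelyMetrizable X
  infer_instance

/-- A map into the space of continuous maps is measurable as soon as its evaluations are. -/
theorem measurable_continuousMap_of_eval {Ω C X : Type*} [MeasurableSpace Ω]
    [TopologicalSpace C] [LocallyCompactSpace C]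
    [SecondCountableTopology C] [TopologicalSpace X] [SecondCountableTopology X]
    [TopologicalSpace.PseudoMetrizableSpace X] [MeasurableSpace X] [BorelSpace X]
    [MeasurableSpace C(C, X)] [BorelSpace C(C, X)] {Φ : Ω → C(C, X)}
    (hΦ : ∀ t, Measurable fun η => Φ η t) : Measurable Φ := by
  let := TopologicalSpace.pseudoMetrizableSpacePseudoMetric X
  have hb : ‹MeasurableSpace C(C, X)› = MeasurableSpace.generateFrom
      (image2 (fun K U ↦ {f : C(C, X) | MapsTo f K U}) {K | IsCompact K} {U | IsOpen U}) :=
    (BorelSpace.measurable_eq (α := C(C, X))).trans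
      (borel_eq_generateFrom_of_subbasis ContinuousMap.compactOpen_eq)
  rw [hb]
  refine measurable_generateFrom ?_
  rintro _ ⟨K, hK, U, hU, rfl⟩
  obtain ⟨D, hDc, hDd⟩ := TopologicalSpace.exists_countable_dense K
  -- On compact K the distance to Uᶜ attains a positive minimum, and a lower bound need only be
  -- tested on a countable dense set. If U is everything, the extended distance is infinite.
  have key : Φ ⁻¹' {f : C(C, X) | MapsTo f K U} =
      ⋃ n : ℕ, ⋂ t ∈ D, {η | ((n : ℝ≥0∞) + 1)⁻¹ ≤ Metric.infEDist (Φ η t) Uᶜ} := by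
    ext η
    simp only [mem_preimage, mem_ofPred_eq, mem_iUnion, mem_iInter]
    have hcont : Continuous fun t : C => Metric.infEDist (Φ η t) Uᶜ :=
      Metric.continuous_infEDist.comp (Φ η).continuous
    have hmem : ∀ y : X, 0 < Metric.infEDist y Uᶜ ↔ y ∈ U := fun y => by
      rw [pos_iff_ne_zero, ne_eq, ← Metric.mem_closure_iff_infEDist_zero,
        (isClosed_compl_iff.2 hU).closure_eq, notMem_compl_iff]
    constructor
    · intro h
      rcases K.eq_empty_or_nonempty with hKe | hKne
      · exact ⟨0, fun t => absurd t.2 (by simp [hKe])⟩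
      obtain ⟨t₀, ht₀, hmin⟩ := IsCompact.exists_isMinOn hK hKne hcont.continuousOn
      obtain ⟨n, hn⟩ := ENNReal.exists_inv_nat_lt ((hmem _).2 (h ht₀)).ne'
      refine ⟨n, fun t _ => ?_⟩
      refine le_trans (le_trans ?_ hn.le) (hmin t.2)
      exact ENNReal.inv_le_inv.2 le_self_add
    · rintro ⟨n, hn⟩ t ht
      rw [← hmem]
      have hcl : IsClosed {t : K | ((n : ℝ≥0∞) + 1)⁻¹ ≤ Metric.infEDist (Φ η t) Uᶜ} :=
        isClosed_le continuous_const (hcont.comp continuous_subtype_val)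
      have hall : ∀ s : K, ((n : ℝ≥0∞) + 1)⁻¹ ≤ Metric.infEDist (Φ η s) Uᶜ := fun s =>
        hcl.closure_subset_iff.2 hn (hDd s)
      refine lt_of_lt_of_le ?_ (hall ⟨t, ht⟩)
      simp [ENNReal.add_eq_top]
  rw [key]
  refine MeasurableSet.iUnion fun n => MeasurableSet.biInter hDc fun t _ => ?_
  exact measurableSet_le measurable_const
    (Metric.continuous_infEDist.measurable.comp (hΦ t))

namespace Tube

/-! ### Composing paths with a partially continuous map -/

section Paths

variable {X Z : Type*} [TopologicalSpace X] [TopologicalSpace Z] [Nonempty Z] {T : ℝ≥0}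
  {f : X → Z} {A : Set X}

theorem isOpen_forall_mem (hA : IsOpen A) : IsOpen {w : PathSpace T X | ∀ t, w t ∈ A} := by
  simpa [MapsTo] using ContinuousMap.isOpen_setOfPred_mapsTo (X := Icc (0 : ℝ≥0) T)
    isCompact_univ hA

theorem isClosed_forall_mem (hA : IsClosed A) : IsClosed {w : PathSpace T X | ∀ t, w t ∈ A} := by
  simp only [ofPred_forall]
  exact isClosed_iInter fun t => hA.preimage (continuous_eval_const t)

theorem mapPath_apply (hf : ContinuousOn f A) {w : PathSpace T X} (hw : ∀ t, w t ∈ A)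
    (t : Icc (0 : ℝ≥0) T) : mapPath f A w t = f (w t) := by
  have h : (∀ t, w t ∈ A) ∧ Continuous fun t => f (w t) :=
    ⟨hw, hf.comp_continuous w.continuous hw⟩
  simp only [mapPath, dif_pos h]
  rfl

theorem continuousOn_mapPath (hA : IsOpen A) (hf : ContinuousOn f A) :
    ContinuousOn (mapPath f A) {w : PathSpace T X | ∀ t, w t ∈ A} := by
  intro w hw
  rw [ContinuousWithinAt, ContinuousMap.tendsto_nhds_compactOpen]
  intro K hK U hU hKU
  have h : ∀ᶠ v : PathSpace T X in 𝓝 w, MapsTo v K (A ∩ f ⁻¹' U) :=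
    (ContinuousMap.isOpen_setOfPred_mapsTo hK (hf.isOpen_inter_preimage hA hU)).mem_nhds
      fun t ht => ⟨hw t, by simpa [mapPath_apply hf hw] using hKU ht⟩
  filter_upwards [nhdsWithin_le_nhds h, self_mem_nhdsWithin] with v hv hvA t ht
  rw [mapPath_apply hf hvA]
  exact (hv ht).2

/-- Continuous on the open set of paths in A, constant on its complement. -/
theorem measurable_mapPath (hA : IsOpen A) (hf : ContinuousOn f A) :
    Measurable (mapPath f A : PathSpace T X → PathSpace T Z) := by
  refine measurable_of_restrict_of_restrict_compl
    (isOpen_forall_mem (T := T) hA).measurableSet ?_ ?_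
  · exact (continuousOn_iff_continuous_domRestrict.1 (continuousOn_mapPath hA hf)).measurable
  · have : ({w : PathSpace T X | ∀ t, w t ∈ A}ᶜ).domRestrict (mapPath f A : _ → PathSpace T Z) =
        fun _ => ContinuousMap.const _ (Classical.arbitrary Z) := by
      funext w
      exact dif_neg fun h => w.2 h.1
    rw [this]
    exact measurable_const

end Paths

/-! ### Conditional laws on path space -/

section Laws

variable {Ω X : Type*} [MeasurableSpace Ω] [TopologicalSpace X]
  [SecondCountableTopology X] [TopologicalSpace.PseudoMetrizableSpace X]
  [MeasurableSpace X] [BorelSpace X]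
  {P : Measure Ω} {T : ℝ≥0} {Y : ℝ≥0 → Ω → X}

theorem measurable_pathUpTo (hY_meas : ∀ t, Measurable (Y t))
    (hY : ∀ η, Continuous fun t => Y t η) : Measurable (pathUpTo T Y hY) :=
  measurable_continuousMap_of_eval fun t => hY_meas t

theorem measurableSet_stays (hY_meas : ∀ t, Measurable (Y t))
    (hY : ∀ η, Continuous fun t => Y t η) {A : Set X} (hA : IsOpen A) :
    MeasurableSet (stays T Y A) := by
  have : stays T Y A = pathUpTo T Y hY ⁻¹' {w | ∀ t, w t ∈ A} := by
    ext η
    exact ⟨fun h t => h t t.2.2, fun h t ht => h ⟨t, zero_le, ht⟩⟩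
  rw [this]
  exact measurable_pathUpTo hY_meas hY (isOpen_forall_mem hA).measurableSet

theorem condLaw_apply (hY_meas : ∀ t, Measurable (Y t))
    (hY : ∀ η, Continuous fun t => Y t η) (A : Set X) {B : Set (PathSpace T X)}
    (hB : MeasurableSet B) :
    condLaw P T Y hY A B = (P (stays T Y A))⁻¹ * P (pathUpTo T Y hY ⁻¹' B ∩ stays T Y A) := by
  have hm := measurable_pathUpTo (T := T) hY_meas hY
  rw [condLaw, Measure.map_apply hm hB, ProbabilityTheory.cond, Measure.smul_apply, smul_eq_mul,
    Measure.restrict_apply (hm hB)]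

/-- The conditioned process stays in the conditioning set. -/
theorem condLaw_compl_forall_mem (hY_meas : ∀ t, Measurable (Y t))
    (hY : ∀ η, Continuous fun t => Y t η) {A : Set X} (hA : IsOpen A) :
    condLaw P T Y hY A {w | ∀ t, w t ∈ A}ᶜ = 0 := by
  rw [condLaw_apply hY_meas hY A (isOpen_forall_mem hA).measurableSet.compl]
  have : pathUpTo T Y hY ⁻¹' {w | ∀ t, w t ∈ A}ᶜ ∩ stays T Y A = ∅ := by
    ext η
    simp only [mem_inter_iff, mem_empty_iff_false, iff_false, not_and]
    exact fun h h' => h fun t => h' t t.2.2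
  rw [this, measure_empty, mul_zero]

/-- The conditional laws are dominated by multiples of the unconditioned one. -/
theorem condLaw_le (hY_meas : ∀ t, Measurable (Y t))
    (hY : ∀ η, Continuous fun t => Y t η) (A : Set X) {B : Set (PathSpace T X)}
    (hB : MeasurableSet B) :
    condLaw P T Y hY A B ≤ (P (stays T Y A))⁻¹ * P.map (pathUpTo T Y hY) B := by
  rw [condLaw_apply hY_meas hY A hB, Measure.map_apply (measurable_pathUpTo hY_meas hY) hB]
  gcongr
  exact inter_subset_left

end Laws

end Tube

namespace Tube

/-! ### Thin tubes and compactness -/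

section Retraction

variable {X Z : Type*} [EMetricSpace X]
  {r : ℝ} {T : ℝ≥0} {ι : Z → X} {ρ : X → Z}

theorem isOpen_tube (ι : Z → X) (ε : ℝ) : IsOpen (tube ι ε) := Metric.isOpen_thickening

theorem tube_mono (ι : Z → X) {ε δ : ℝ} (h : ε ≤ δ) : tube ι ε ⊆ tube ι δ :=
  Metric.thickening_mono h _

theorem mem_tube (ι : Z → X) {ε : ℝ} (hε : 0 < ε) (p : Z) : ι p ∈ tube ι ε :=
  Metric.self_subset_thickening hε _ (mem_range_self p)

variable [TopologicalSpace Z] [CompactSpace Z]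

/-- A retraction onto a compact set moves the points of thin tubes only a little. -/
theorem exists_edist_retraction_lt (hι : Continuous ι) (hr : 0 < r)
    (hρ : ContinuousOn ρ (tube ι r)) (hρι : ∀ p, ρ (ι p) = p) {δ : ℝ≥0∞} (hδ : 0 < δ) :
    ∃ ε > 0, ∀ y ∈ Metric.cthickening ε (range ι), edist (ι (ρ y)) y < δ := by
  have hc : ContinuousOn (fun y => edist (ι (ρ y)) y) (tube ι r) :=
    continuous_edist.comp_continuousOn ((hι.comp_continuousOn hρ).prodMk continuousOn_id)
  have ho := hc.isOpen_inter_preimage (isOpen_tube ι r) (isOpen_Iio (a := δ))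
  obtain ⟨ε, hε, h⟩ := (isCompact_range hι).exists_cthickening_subset_open ho (by
    rintro _ ⟨p, rfl⟩
    exact ⟨mem_tube ι hr p, by simpa [hρι] using hδ⟩)
  exact ⟨ε, hε, fun y hy => (h hy).2⟩

/-- Paths staying in ever thinner tubes converge as soon as their projections do. -/
theorem tendsto_of_tendsto_mapPath [Nonempty Z] (hι : Continuous ι) (hr : 0 < r)
    (hρ : ContinuousOn ρ (tube ι r)) (hρι : ∀ p, ρ (ι p) = p)
    {l : Filter (PathSpace T X)} {k : PathSpace T Z}
    (hl : ∀ ε > 0, ∀ᶠ w in l, ∀ t, w t ∈ Metric.cthickening ε (range ι))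
    (hk : Tendsto (mapPath ρ (tube ι r)) l (𝓝 k)) :
    l ≤ 𝓝 ((⟨ι, hι⟩ : C(Z, X)).comp k) := by
  change Tendsto id l _
  have h1 : Tendsto (fun w => (⟨ι, hι⟩ : C(Z, X)).comp (mapPath ρ (tube ι r) w)) l
      (𝓝 ((⟨ι, hι⟩ : C(Z, X)).comp k)) :=
    ((ContinuousMap.continuous_postcomp _).tendsto k).comp hk
  rw [ContinuousMap.tendsto_iff_tendstoUniformly, EMetric.tendstoUniformly_iff] at h1 ⊢
  intro δ hδ
  have hδ2 : 0 < δ / 2 := ENNReal.half_pos hδ.ne'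
  obtain ⟨ε, hε, hedist⟩ := exists_edist_retraction_lt hι hr hρ hρι hδ2
  have hsub : Metric.cthickening (r / 2) (range ι) ⊆ tube ι r :=
    Metric.cthickening_subset_thickening' hr (by linarith) _
  filter_upwards [h1 _ hδ2, hl ε hε, hl (r / 2) (by linarith)] with w hw hwε hwr t
  have h2 := hw t
  simp only [ContinuousMap.comp_apply, ContinuousMap.coe_mk,
    mapPath_apply hρ (fun t => hsub (hwr t))] at h2
  calc edist (ι (k t)) (w t) ≤ edist (ι (k t)) (ι (ρ (w t))) + edist (ι (ρ (w t))) (w t) :=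
        edist_triangle _ _ _
    _ < δ / 2 + δ / 2 := ENNReal.add_lt_add h2 (hedist _ (hwε t))
    _ = δ := ENNReal.add_halves δ

/-- Paths which for every `n` are in a compact set `K n` or in a thin tube with projection in a
compact set `K'` form a compact set. -/
theorem isCompact_iInter_union [Nonempty Z] [T2Space Z] (hι : Continuous ι)
    (hρ : ContinuousOn ρ (tube ι r)) (hρι : ∀ p, ρ (ι p) = p)
    {K' : Set (PathSpace T Z)} (hK' : IsCompact K') {K : ℕ → Set (PathSpace T X)}
    (hK : ∀ n, IsCompact (K n)) {e : ℕ → ℝ} (he0 : ∀ n, 0 < e n) (her : ∀ n, e n < r)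
    (he : Tendsto e atTop (𝓝 0)) :
    IsCompact (⋂ n, (K n ∪ {w : PathSpace T X |
      (∀ t, w t ∈ Metric.cthickening (e n) (range ι)) ∧ mapPath ρ (tube ι r) w ∈ K'})) := by
  have hr : 0 < r := (he0 0).trans (her 0)
  set F : ℕ → Set (PathSpace T X) := fun n => {w | (∀ t, w t ∈ Metric.cthickening (e n) (range ι)) ∧
    mapPath ρ (tube ι r) w ∈ K'} with hF
  -- As `e n < r`, the closed tube stays where composition with `ρ` is continuous.
  have hFc : ∀ n, IsClosed (F n) := fun n => by
    have hsub : {w : PathSpace T X | ∀ t, w t ∈ Metric.cthickening (e n) (range ι)} ⊆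
        {w | ∀ t, w t ∈ tube ι r} := fun w hw t =>
      Metric.cthickening_subset_thickening' hr (her n) _ (hw t)
    exact ((continuousOn_mapPath (isOpen_tube ι r) hρ).mono hsub).preimage_isClosed_of_isClosed
      (isClosed_forall_mem Metric.isClosed_cthickening) hK'.isClosed
  have hBc : IsClosed (⋂ n, (K n ∪ F n)) := isClosed_iInter fun n => (hK n).isClosed.union (hFc n)
  rw [isCompact_iff_ultrafilter_le_nhds]
  intro U hU
  rw [le_principal_iff] at hU
  suffices ∃ w, (U : Filter (PathSpace T X)) ≤ 𝓝 w by
    obtain ⟨w, hw⟩ := this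
    exact ⟨w, hBc.mem_of_tendsto (f := id) hw hU, hw⟩
  by_cases h : ∃ n, K n ∈ U
  · obtain ⟨n, hn⟩ := h
    obtain ⟨w, -, hw⟩ := (hK n).ultrafilter_le_nhds U (le_principal_iff.2 hn)
    exact ⟨w, hw⟩
  -- An ultrafilter containing no `K n` contains every `F n`: its projections converge in `K'` while
  -- its tubes shrink to zero.
  have hFU : ∀ n, F n ∈ U := fun n =>
    (Ultrafilter.union_mem_iff.1 (mem_of_superset hU (iInter_subset _ n))).resolve_left
      fun hn => h ⟨n, hn⟩
  obtain ⟨k, -, hk⟩ := hK'.ultrafilter_le_nhds (U.map (mapPath ρ (tube ι r)))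
    (le_principal_iff.2 (Ultrafilter.mem_map.2 (mem_of_superset (hFU 0) fun w hw => hw.2)))
  refine ⟨_, tendsto_of_tendsto_mapPath hι hr hρ hρι (fun ε hε => ?_) hk⟩
  obtain ⟨n, hn⟩ := (he.eventually_lt_const hε).exists
  filter_upwards [hFU n] with w hw t
  exact Metric.cthickening_mono hn.le _ (hw.1 t)

end Retraction

/-! ### The two implications -/

section Tightness

variable {X Z : Type*} [EMetricSpace X] [PolishSpace X] [MeasurableSpace X] [BorelSpace X]
  [TopologicalSpace Z] [T2Space Z] [Nonempty Z]
  {ι : Z → X} {ρ : X → Z} {r : ℝ}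
  {Ω : Type*} [MeasurableSpace Ω] {P : Measure Ω} {T : ℝ≥0}
  {Y : ℝ≥0 → Ω → X}

theorem isTightMeasureSet_map_mapPath (hr : 1 < r)
    (hρ : ContinuousOn ρ (tube ι r)) (hY_meas : ∀ t, Measurable (Y t))
    (hY : ∀ η, Continuous fun t => Y t η)
    (h : IsTightMeasureSet ((fun ε : ℝ => condLaw P T Y hY (tube ι ε)) '' Ioc 0 1)) :
    IsTightMeasureSet ((fun ε : ℝ => (condLaw P T Y hY (tube ι ε)).map
      (mapPath ρ (tube ι r))) '' Ioc 0 1) := by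
  rw [isTightMeasureSet_iff_exists_isCompact_measure_compl_le] at h ⊢
  intro δ hδ
  obtain ⟨K, hK, hKδ⟩ := h δ hδ
  have hcl : IsClosed {w : PathSpace T X | ∀ t, w t ∈ Metric.cthickening 1 (range ι)} :=
    isClosed_forall_mem Metric.isClosed_cthickening
  -- The closed 1-tube contains all tubes with ε ≤ 1 and, since `1 < r`, lies in the domain of
  -- continuity.
  have hK' : IsCompact (mapPath ρ (tube ι r) ''
      (K ∩ {w : PathSpace T X | ∀ t, w t ∈ Metric.cthickening 1 (range ι)})) :=
    (hK.inter_right hcl).image_of_continuousOn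
      ((continuousOn_mapPath (isOpen_tube ι r) hρ).mono fun w hw t =>
        Metric.cthickening_subset_thickening' (by linarith) hr _ (hw.2 t))
  refine ⟨_, hK', ?_⟩
  rintro _ ⟨ε, hε, rfl⟩
  rw [Measure.map_apply (measurable_mapPath (isOpen_tube ι r) hρ) hK'.isClosed.measurableSet.compl]
  calc condLaw P T Y hY (tube ι ε) _
      ≤ condLaw P T Y hY (tube ι ε) (Kᶜ ∪ {w | ∀ t, w t ∈ tube ι ε}ᶜ) := by
        refine measure_mono fun w hw => ?_
        by_contra hcon
        rw [mem_union, not_or, notMem_compl_iff, notMem_compl_iff] at hcon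
        exact hw ⟨w, ⟨hcon.1, fun t => Metric.thickening_subset_cthickening _ _
          (tube_mono ι hε.2 (hcon.2 t))⟩, rfl⟩
    _ ≤ δ + 0 := (measure_union_le _ _).trans
        (add_le_add (hKδ _ ⟨ε, hε, rfl⟩)
          (condLaw_compl_forall_mem hY_meas hY (isOpen_tube ι ε)).le)
    _ = δ := add_zero δ

theorem isTightMeasureSet_of_map_mapPath [CompactSpace Z] [IsFiniteMeasure P]
    (hι : Continuous ι) (hr : 1 < r)
    (hρ : ContinuousOn ρ (tube ι r)) (hρι : ∀ p, ρ (ι p) = p) (hY_meas : ∀ t, Measurable (Y t))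
    (hY : ∀ η, Continuous fun t => Y t η)
    (hpos : ∀ ε : ℝ, 0 < ε → 0 < P (stays T Y (tube ι ε)))
    (h : IsTightMeasureSet ((fun ε : ℝ => (condLaw P T Y hY (tube ι ε)).map
      (mapPath ρ (tube ι r))) '' Ioc 0 1)) :
    IsTightMeasureSet ((fun ε : ℝ => condLaw P T Y hY (tube ι ε)) '' Ioc 0 1) := by
  have hPolish : PolishSpace (PathSpace T X) := polishSpace_continuousMap _ _
  -- A finite measure on a Polish space is tight.
  have hν : IsTightMeasureSet {P.map (pathUpTo T Y hY)} := isTightMeasureSet_singleton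
  rw [isTightMeasureSet_iff_exists_isCompact_measure_compl_le] at h hν ⊢
  intro δ hδ
  have hδ2 : 0 < δ / 2 := ENNReal.half_pos hδ.ne'
  obtain ⟨K', hK', hK'δ⟩ := h (δ / 2) hδ2
  obtain ⟨d, hd, hdδ⟩ := ENNReal.exists_pos_sum_of_countable' hδ2.ne' ℕ
  set e : ℕ → ℝ := fun n => 1 / ((n : ℝ) + 1) with he_def
  have he0 : ∀ n, 0 < e n := fun n => Nat.one_div_pos_of_nat
  have he1 : ∀ n, e n ≤ 1 := fun n => by
    simpa [he_def] using inv_le_one_of_one_le₀ (by linarith [n.cast_nonneg (α := ℝ)] :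
      (1 : ℝ) ≤ (n : ℝ) + 1)
  -- The factor `P (stays …)` will cancel the normalisation of the conditional law.
  have hK : ∀ n, ∃ K : Set (PathSpace T X), IsCompact K ∧
      P.map (pathUpTo T Y hY) Kᶜ ≤ P (stays T Y (tube ι (e n))) * d n := fun n => by
    obtain ⟨K, hK, hKn⟩ := hν (P (stays T Y (tube ι (e n))) * d n)
      (ENNReal.mul_pos (hpos _ (he0 n)).ne' (hd n).ne')
    exact ⟨K, hK, hKn _ rfl⟩
  choose K hKc hKd using hK
  refine ⟨_, isCompact_iInter_union hι hρ hρι hK' hKc he0 (fun n => (he1 n).trans_lt hr)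
    tendsto_one_div_add_atTop_nhds_zero_nat, ?_⟩
  rintro _ ⟨ε, hε, rfl⟩
  dsimp only
  -- For fixed ε, indices with `e n ≤ ε` are met through `K n`, the others through the tube and
  -- `K'`.
  have hsub : (⋂ n, (K n ∪ {w : PathSpace T X |
      (∀ t, w t ∈ Metric.cthickening (e n) (range ι)) ∧ mapPath ρ (tube ι r) w ∈ K'}))ᶜ ⊆
      ((⋃ n, ⋃ _ : e n ≤ ε, (K n)ᶜ) ∪ mapPath ρ (tube ι r) ⁻¹' K'ᶜ) ∪
        {w | ∀ t, w t ∈ tube ι ε}ᶜ := by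
    intro w hw
    by_contra hcon
    simp only [mem_union, mem_iUnion, not_or, not_exists, mem_preimage, notMem_compl_iff] at hcon
    refine hw (mem_iInter.2 fun n => ?_)
    rcases le_or_gt (e n) ε with hn | hn
    · exact Or.inl (hcon.1.1 n hn)
    · exact Or.inr ⟨fun t => Metric.thickening_subset_cthickening _ _
        (tube_mono ι hn.le (hcon.2 t)), hcon.1.2⟩
  have h1 : ∀ n, condLaw P T Y hY (tube ι ε) (⋃ _ : e n ≤ ε, (K n)ᶜ) ≤ d n := fun n => by
    by_cases hn : e n ≤ ε
    · simp only [hn, iUnion_true]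
      refine (condLaw_le hY_meas hY _ (hKc n).isClosed.measurableSet.compl).trans ?_
      rw [← ENNReal.div_eq_inv_mul]
      refine ENNReal.div_le_of_le_mul' ((hKd n).trans ?_)
      gcongr
      exact fun η hη t ht => tube_mono ι hn (hη t ht)
    · simp [hn]
  have h2 : condLaw P T Y hY (tube ι ε) (mapPath ρ (tube ι r) ⁻¹' K'ᶜ) ≤ δ / 2 := by
    rw [← Measure.map_apply (measurable_mapPath (isOpen_tube ι r) hρ)
      hK'.isClosed.measurableSet.compl]
    exact hK'δ _ ⟨ε, hε, rfl⟩
  calc condLaw P T Y hY (tube ι ε) _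
      ≤ condLaw P T Y hY (tube ι ε) (⋃ n, ⋃ _ : e n ≤ ε, (K n)ᶜ) +
          condLaw P T Y hY (tube ι ε) (mapPath ρ (tube ι r) ⁻¹' K'ᶜ) +
          condLaw P T Y hY (tube ι ε) {w | ∀ t, w t ∈ tube ι ε}ᶜ :=
        (measure_mono hsub).trans ((measure_union_le _ _).trans
          (add_le_add (measure_union_le _ _) le_rfl))
    _ ≤ δ / 2 + δ / 2 + 0 := by
        refine add_le_add (add_le_add ?_ h2)
          (condLaw_compl_forall_mem hY_meas hY (isOpen_tube ι ε)).le
        exact (measure_iUnion_le _).trans ((ENNReal.tsum_le_tsum h1).trans hdδ.le)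
    _ = δ := by rw [add_zero, ENNReal.add_halves]

end Tightness

/-! ### The tubular projection -/

section Projection

variable {E' : Type*} [NormedAddCommGroup E'] [NormedSpace ℝ E']
    {H' : Type*} [TopologicalSpace H'] {I' : ModelWithCorners ℝ E' H'}
    {E : Type*} [NormedAddCommGroup E] [NormedSpace ℝ E]
    {H : Type*} [TopologicalSpace H] {I : ModelWithCorners ℝ E H}
    {L : Type*} [TopologicalSpace L] [ChartedSpace H' L]
    {M : Type*} [EMetricSpace M] [ChartedSpace H M] [IsManifold I ∞ M]
    [RiemannianBundle (fun x : M => TangentSpace I x)]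
    {ι : L → M} {r : ℝ}

theorem IsGeodesicFrom.apply_zero {z : TangentBundle I M} {γ : ℝ → M}
    (h : IsGeodesicFrom I z γ) : γ 0 = z.proj :=
  congrArg TotalSpace.proj h.velocity

/-- At speed zero, local minimisation makes γ locally constant on the connected interval. -/
theorem IsGeodesicFrom.apply_one_of_norm_eq_zero {z : TangentBundle I M} {γ : ℝ → M}
    (h : IsGeodesicFrom I z γ) (hz : ‖z.snd‖ = 0) : γ 1 = γ 0 := by
  have hloc : IsLocallyConstant fun t : Icc (0 : ℝ) 1 => γ t := by
    rw [IsLocallyConstant.iff_eventually_eq]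
    intro t
    obtain ⟨δ, hδ, hmin⟩ := h.locally_minimizing t t.2
    filter_upwards [Metric.ball_mem_nhds t hδ] with s hs
    have := hmin s s.2 t t.2 (by simpa [Subtype.dist_eq, Real.dist_eq] using hs) (by simpa using hδ)
    simpa [hz] using this
  exact hloc.apply_eq_of_preconnectedSpace ⟨1, by simp⟩ ⟨0, by simp⟩

theorem expMap_of_norm_eq_zero {z : TangentBundle I M} (hz : ‖z.snd‖ = 0) :
    expMap I z = z.proj := by
  unfold expMap
  split_ifs with h
  · rw [h.choose_spec.apply_one_of_norm_eq_zero hz, h.choose_spec.apply_zero]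
  · rfl

theorem IsTubularRadius.exists_expMap_proj [Nonempty L] (h : IsTubularRadius I' I ι r) {y : M}
    (hy : y ∈ tube ι r) : ∃ v : TangentSpace I (ι (proj I' I ι r y)),
      IsNormal I' I ι _ v ∧ ‖v‖ < r ∧ expMap I ⟨ι (proj I' I ι r y), v⟩ = y := by
  obtain ⟨_, ⟨p, v, hv, hvr, rfl⟩, hvy⟩ := h.2.1.surjOn hy
  exact Classical.epsilon_spec (p := fun p : L => ∃ v : TangentSpace I (ι p),
    IsNormal I' I ι p v ∧ ‖v‖ < r ∧ expMap I ⟨ι p, v⟩ = y) ⟨p, v, hv, hvr, hvy⟩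

/-- The zero vector at `p` is normal and exponentiates to `ι p`; injectivity of exp on NL(r) leaves
no other foot point. -/
theorem IsTubularRadius.proj_apply [Nonempty L] (h : IsTubularRadius I' I ι r) (hr : 0 < r)
    (hι : Function.Injective ι) (p : L) : proj I' I ι r (ι p) = p := by
  have h0 : ‖(0 : TangentSpace I (ι p))‖ = 0 := norm_zero
  obtain ⟨v, hv, hvr, hvy⟩ := h.exists_expMap_proj (mem_tube ι hr p)
  have := h.2.1.injOn ⟨_, v, hv, hvr, rfl⟩
    ⟨p, 0, fun w => inner_zero_left _, by rwa [h0], rfl⟩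
    (hvy.trans (expMap_of_norm_eq_zero (z := ⟨ι p, 0⟩) h0).symm)
  exact hι (congrArg TotalSpace.proj this)

/-- On the tube, `ι ∘ π` is the bundle projection after the smooth inverse of exp, and the embedding
`ι` reflects continuity. -/
theorem IsTubularRadius.continuousOn_proj [Nonempty L] (h : IsTubularRadius I' I ι r)
    (hι : IsEmbedding ι) : ContinuousOn (proj I' I ι r) (tube ι r) := by
  obtain ⟨g, hg, hgs⟩ := h.2.2.2
  rw [hι.continuousOn_iff]
  refine ((FiberBundle.continuous_proj E (TangentSpace I : M → Type _)).comp_continuousOn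
    hgs.continuousOn).congr fun y hy => ?_
  obtain ⟨v, hv, hvr, hvy⟩ := h.exists_expMap_proj hy
  have := hg.1 ⟨_, v, hv, hvr, rfl⟩
  rw [hvy] at this
  simp [this]

end Projection

end Tube

end

theorem mainTheorem5 {l m : ℕ} (hlm : l < m)
    -- the Riemannian manifold `M`
    {M : Type*} [EMetricSpace M] [SecondCountableTopology M]
    [ChartedSpace (EuclideanSpace ℝ (Fin m)) M] [IsManifold (𝓡 m) ∞ M]
    [RiemannianBundle (fun x : M => TangentSpace (𝓡 m) x)]
    [IsContMDiffRiemannianBundle (𝓡 m) ∞ (EuclideanSpace ℝ (Fin m))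
      (fun x : M => TangentSpace (𝓡 m) x)]
    [IsRiemannianManifold (𝓡 m) M]
    [MeasurableSpace M] [BorelSpace M]
    -- the closed connected submanifold `L`, given by its embedding `ι`
    {L : Type*} [TopologicalSpace L] [CompactSpace L] [ConnectedSpace L]
    [ChartedSpace (EuclideanSpace ℝ (Fin l)) L] [IsManifold (𝓡 l) ∞ L]
    (ι : L → M) (hι : Manifold.IsSmoothEmbedding (𝓡 l) (𝓡 m) ∞ ι)
    -- the tube
    (r : ℝ) (hr : 1 < r) (hr_tube : Tube.IsTubularRadius (𝓡 l) (𝓡 m) ι r)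
    -- the process `Y` with continuous paths, started at `x ∈ L`
    {Ω : Type*} [MeasurableSpace Ω] (P : Measure Ω) [IsProbabilityMeasure P]
    (T : ℝ≥0) (hT : 0 < T)
    (Y : ℝ≥0 → Ω → M) (hY_meas : ∀ t, Measurable (Y t))
    (hY : ∀ η, Continuous fun t => Y t η)
    (x : L) (hx : ∀ᵐ η ∂P, Y 0 η = ι x)
    -- the conditioning is possible for every tube
    (hpos : ∀ ε : ℝ, 0 < ε → 0 < P (Tube.stays T Y (Tube.tube ι ε))) :
    IsTightMeasureSet
        ((fun ε : ℝ => (Tube.condLaw P T Y hY (Tube.tube ι ε)).map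
          (Tube.mapPath (Tube.proj (𝓡 l) (𝓡 m) ι r) (Tube.tube ι r))) '' Ioc 0 1) ↔
      IsTightMeasureSet
        ((fun ε : ℝ => Tube.condLaw P T Y hY (Tube.tube ι ε)) '' Ioc 0 1) := by
  -- Finite-dimensional charts give local compactness, hence a Polish topology even if the metric of
  -- `M` is incomplete.
  have : LocallyCompactSpace M :=
    ChartedSpace.locallyCompactSpace (EuclideanSpace ℝ (Fin m)) M
  have : PolishSpace M := polishSpace_of_locallyCompactSpace M
  have : T2Space L := hι.isEmbedding.t2Space
  have hρ := hr_tube.continuousOn_proj hι.isEmbedding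
  exact ⟨Tube.isTightMeasureSet_of_map_mapPath hι.isEmbedding.continuous hr hρ
      (hr_tube.proj_apply (one_pos.trans hr) hι.isEmbedding.injective) hY_meas hY hpos,
    Tube.isTightMeasureSet_map_mapPath hr hρ hY_meas hY⟩
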